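/- Let $\Bbbk$ be a field and let $G$ be a finite acyclic quiver with vertex set $G_0$, regarded as a fully commutative quiver: a representation $M$ of $G$ consists of finite-dimensional $\Bbbk$-vector spaces $M_u$ ($u\in G_0$) and linear maps $M(\alpha)$ for the arrows $\alpha$, such that $M(p)=M(q)$ for any two parallel paths $p,q$ of positive length, where $M(p)$ denotes the composite of the maps along $p$ ($M(p)=\mathrm{id}$ for a trivial path). An interval of $G$ is a nonempty connected full subquiver $I$ that is convex (every path of $G$ with both ends in $I$ has all its vertices in $I$); $I_0$ is its vertex set, and $\mathbb I_G$ is the set of intervals, ordered by inclusion of vertex sets. For $I\in\mathbb I_G$, the interval representation $V_I$ has $(V_I)_u=\Bbbk$ for $u\in I_0$ and $0$ otherwise, with $V_I(\alpha)=\mathrm{id}$ if both ends of $\alpha$ lie in $I_0$ and $V_I(\alpha)=0$ otherwise. The set $E(I)$ of essential vertices consists of the sources and the sinks of $I$. A course on $G$ is a pair $(C,F)$ of a connected quiver $C$ with finitely many vertices and a map $F\colon C_0\to G_0$ such that for every arrow $x\to y$ of $C$ there is a path from $F(x)$ to $F(y)$ in $G$. The tour of $M$ along $(C,F)$ is the representation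 $\mathrm{Tour}_{(C,F)}(M)$ of $C$ with the space $M_{F(x)}$ at $x\in C_0$ and with the evaluation of $M$ on a path from $F(x)$ to $F(y)$ at each arrow $x\to y$ (by full commutativity the choice of the path does not matter). An essential assignment $\xi$ assigns to each $I\in\mathbb I_G$ a course $\xi(I)=(C,F)$ with $E(I)\subseteq F(C_0)\subseteq I_0$. The $\xi$-compressed multiplicity $c^\xi_M(I)$ is the multiplicity of $\mathrm{Tour}_{\xi(I)}(V_I)$ in $\mathrm{Tour}_{\xi(I)}(M)$, that is, the number of summands isomorphic to $\mathrm{Tour}_{\xi(I)}(V_I)$ in a decomposition of $\mathrm{Tour}_{\xi(I)}(M)$ into indecomposable representations. The interval approximation of $M$ is the unique function $\delta^\xi_M\colon\mathbb I_G\to\mathbb Z$ with $$c^\xi_M(I)=\sum_{J\in\mathbb I_G,\ I\le J}\delta^\xi_M(J)\qquad\text{for all } I\in\mathbb I_G.$$ **Theorem.** For every essential assignment $\xi$ on $G$, every representation $M$ of $G$ and every path $p$ in $G$ (trivial paths included), $$\operatorname{rank} M(p)=\sum_{I\in\mathbb I_G}\delta^\xi_M(I)\cdot\operatorname{rank} V_I(p).$$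 -/

import Mathlib

open CategoryTheory CategoryTheory.Limits

universe u v w c d

/-- A quiver is acyclic if every path from a vertex to itself is trivial. -/
def IsAcyclicQuiver (V : Type v) [Quiver.{w} V] : Prop :=
  ∀ (a : V) (p : Quiver.Path a a), p.length = 0

/-- The underlying simple graph of a quiver (connectivity does not see loops, multiplicities and
orientations of arrows). -/
def underlyingGraph (V : Type v) [Quiver.{w} V] : SimpleGraph V :=
  SimpleGraph.fromRel fun a b => Nonempty (a ⟶ b)

/-! ### Intervals -/

/-- An interval of a fully commutative quiver on `V`: a connected (in particular nonempty) convex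
full subquiver, given by its set of vertices. -/
@[ext]
structure QuiverInterval (V : Type v) [Quiver.{w} V] where
  carrier : Set V
  connected : ((underlyingGraph V).induce carrier).Connected
  convex : ∀ {a x b : V}, a ∈ carrier → b ∈ carrier →
    Quiver.Path a x → Quiver.Path x b → x ∈ carrier

namespace QuiverInterval

variable {V : Type v} [Quiver.{w} V]

theorem carrier_injective :
    Function.Injective (carrier : QuiverInterval V → Set V) :=
  fun _ _ h => QuiverInterval.ext h

/-- Intervals are ordered by containment of their vertex sets. -/
instance : PartialOrder (QuiverInterval V) :=
  PartialOrder.lift carrier carrier_injective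

instance [Finite V] : Finite (QuiverInterval V) :=
  Finite.of_injective carrier carrier_injective

noncomputable instance [Finite V] : Fintype (QuiverInterval V) := Fintype.ofFinite _

/-- The essential vertices of an interval: the vertices that are a source or a sink of the full
subquiver on the interval. -/
def essentialVertices (I : QuiverInterval V) : Set V :=
  {x | x ∈ I.carrier ∧
    ((∀ y ∈ I.carrier, IsEmpty (y ⟶ x)) ∨ (∀ y ∈ I.carrier, IsEmpty (x ⟶ y)))}

end QuiverInterval

/-! ### Representations -/

/-- The category of finite-dimensional representations of a quiver `V`, i.e. of functors from the
path category of `V` to finite-dimensional vector spaces. -/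
abbrev QuiverRep (k : Type u) [Field k] (V : Type v) [Quiver.{w} V] :=
  Paths V ⥤ FGModuleCat.{u} k

/-- The evaluation `M(p)` of a representation on a path, as a linear map. -/
def QuiverRep.eval {k : Type u} [Field k] {V : Type v} [Quiver.{w} V] (M : QuiverRep k V)
    {a b : V} (p : Quiver.Path a b) :
    M.obj ((Paths.of V).obj a) →ₗ[k] M.obj ((Paths.of V).obj b) :=
  (M.map (X := (Paths.of V).obj a) (Y := (Paths.of V).obj b) p).hom.hom

/-- A representation satisfies the full commutativity relations if `M(p) = M(q)` for all
parallel paths `p`, `q` of positive length. -/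
def satisfiesFullCommutativity (k : Type u) [Field k] (V : Type v) [Quiver.{w} V] :
    ObjectProperty (QuiverRep k V) :=
  fun M => ∀ ⦃a b : V⦄ (p q : Quiver.Path a b), 1 ≤ p.length → 1 ≤ q.length →
    QuiverRep.eval M p = QuiverRep.eval M q

/-- The category of finite-dimensional representations of the fully commutative quiver on `V`. -/
abbrev FCRep (k : Type u) [Field k] (V : Type v) [Quiver.{w} V] :=
  (satisfiesFullCommutativity k V).FullSubcategory

/-- The rank of a representation on a path. -/
noncomputable def QuiverRep.rank {k : Type u} [Field k] {V : Type v} [Quiver.{w} V]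
    (M : QuiverRep k V) {a b : V} (p : Quiver.Path a b) : ℕ :=
  Module.finrank k (LinearMap.range (M.eval p))

section intervalRep

variable (k : Type u) [Field k] {V : Type v} [Quiver.{w} V] (I : QuiverInterval V)

open Classical in
/-- The space of the interval representation at a vertex: all of `k` on the interval, and `0`
outside of it. -/
noncomputable def intervalSpace (x : V) : Submodule k k :=
  if x ∈ I.carrier then ⊤ else ⊥

open Classical in
/-- The map of the interval representation between two vertices: the identity of `k` if both lie in
the interval, and `0` otherwise. -/
noncomputable def intervalMap (x y : V) : intervalSpace k I x →ₗ[k] intervalSpace k I y :=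
  if h : x ∈ I.carrier ∧ y ∈ I.carrier then
    Submodule.inclusion (by simp [intervalSpace, h.1, h.2])
  else 0

/-- The interval representation `V_I` as a representation of the quiver without relations. -/
noncomputable def intervalQuiverRep : QuiverRep k V :=
  Paths.lift
    { obj := fun x => FGModuleCat.of k (intervalSpace k I x)
      map := fun {x y} _ => FGModuleCat.ofHom (intervalMap k I x y) }

theorem intervalSpace_of_notMem {x : V} (hx : x ∉ I.carrier) (z : intervalSpace k I x) : z = 0 := by
  obtain ⟨z, hz⟩ := z
  rw [intervalSpace, if_neg hx, Submodule.mem_bot] at hz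
  exact Subtype.ext hz

theorem intervalMap_self (x : V) : intervalMap k I x x = LinearMap.id := by
  by_cases hx : x ∈ I.carrier
  · rw [intervalMap, dif_pos ⟨hx, hx⟩]
    rfl
  · ext z
    rw [intervalSpace_of_notMem k I hx z, map_zero, map_zero]

theorem intervalMap_comp {x y z : V} (p : Quiver.Path x y) (q : Quiver.Path y z) :
    intervalMap k I y z ∘ₗ intervalMap k I x y = intervalMap k I x z := by
  by_cases hx : x ∈ I.carrier
  · by_cases hz : z ∈ I.carrier
    · have hy := I.convex hx hz p q
      rw [intervalMap, dif_pos ⟨hy, hz⟩, intervalMap, dif_pos ⟨hx, hy⟩, intervalMap,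
        dif_pos ⟨hx, hz⟩]
      rfl
    · rw [intervalMap, dif_neg (fun h => hz h.2), LinearMap.zero_comp, intervalMap,
        dif_neg (fun h => hz h.2)]
  · ext t
    rw [intervalSpace_of_notMem k I hx t, map_zero, map_zero]

/-- The interval representation on any path depends on the two ends of the path only. -/
theorem intervalQuiverRep_eval {a b : V} (p : Quiver.Path a b) :
    (intervalQuiverRep k I).eval p = intervalMap k I a b := by
  induction p with
  | nil => exact (intervalMap_self k I a).symm
  | cons p e ih =>
    exact Eq.trans (congrArg (fun f => intervalMap k I _ _ ∘ₗ f) ih) (intervalMap_comp k I p e.toPath)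

/-- The interval representation `V_I` of the fully commutative quiver. -/
noncomputable def intervalRep : FCRep k V where
  obj := intervalQuiverRep k I
  property := fun _ _ p q _ _ =>
    (intervalQuiverRep_eval k I p).trans (intervalQuiverRep_eval k I q).symm

end intervalRep

/-! ### Multiplicities -/

instance {k : Type u} [Field k] {V : Type v} [Quiver.{w} V] :
    HasFiniteBiproducts (QuiverRep k V) :=
  Abelian.hasFiniteBiproducts

/-- `M` is isomorphic to a finite direct sum of indecomposables, exactly `m` of which are isomorphic
to `L`. -/
def QuiverRep.HasMultiplicity {k : Type u} [Field k] {V : Type v} [Quiver.{w} V]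
    (M L : QuiverRep k V) (m : ℕ) : Prop :=
  ∃ (n : ℕ) (X : Fin n → QuiverRep k V),
    (∀ i, Indecomposable (X i)) ∧ Nonempty (M ≅ ⨁ X) ∧ Nat.card {i // Nonempty (X i ≅ L)} = m

/-- The multiplicity function `d_M` evaluated at an indecomposable representation `L` of a quiver
with finitely many vertices: the number of summands isomorphic to `L` in a decomposition of `M` into
indecomposables. By the Krull-Schmidt theorem there is exactly one number with this property, so
that the supremum is taken over a singleton. -/
noncomputable def QuiverRep.multiplicity {k : Type u} [Field k] {V : Type v} [Quiver.{w} V]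
    (M L : QuiverRep k V) : ℕ :=
  sSup {m | QuiverRep.HasMultiplicity M L m}

/-! ### Courses, tours and compressed multiplicities -/

/-- A course on (the fully commutative quiver on) `V`: a connected quiver with a labeling map to
`V`, such that for each arrow there is a path in `V` between the labels of its ends. Cycles, loops
and multiple arrows are allowed; finiteness of the vertex set makes the Krull-Schmidt theorem
available. -/
structure Course (V : Type v) [Quiver.{w} V] where
  vertex : Type c
  [quiver : Quiver.{d} vertex]
  [finite : Finite vertex]
  connected : (underlyingGraph vertex).Connected
  label : vertex → V
  exists_path : ∀ {x y : vertex}, (x ⟶ y) → Nonempty (Quiver.Path (label x) (label y))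

attribute [instance] Course.quiver Course.finite

namespace Course

variable {V : Type v} [Quiver.{w} V]

/-- The tour on a course: the representation of the quiver of the course with the space `M_{F(x)}`
at a vertex `x`, and with the evaluation of `M` on a path from `F(x)` to `F(y)` at an arrow
`x ⟶ y`. The choice of the path does not matter when `V` is acyclic, as `M` satisfies the full
commutativity relations. -/
noncomputable def tour {k : Type u} [Field k] (C : Course.{v, w, c, d} V) (M : FCRep k V) :
    QuiverRep k C.vertex :=
  Paths.lift
    { obj := fun x => M.obj.obj ((Paths.of V).obj (C.label x))
      map := fun {x y} α => M.obj.map (X := (Paths.of V).obj (C.label x))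
        (Y := (Paths.of V).obj (C.label y)) (Classical.choice (C.exists_path α)) }

/-- A course is essential in an interval `I` if its labels lie in `I` and all essential vertices
of `I` occur as labels. -/
def IsEssential (C : Course.{v, w, c, d} V) (I : QuiverInterval V) : Prop :=
  I.essentialVertices ⊆ Set.range C.label ∧ Set.range C.label ⊆ I.carrier

end Course

/-- An essential assignment: a map that assigns to each interval an essential course in it. -/
structure EssentialAssignment (V : Type v) [Quiver.{w} V] where
  course : QuiverInterval V → Course.{v, w, c, d} V
  isEssential : ∀ I, (course I).IsEssential I

section approximation

variable {k : Type u} [Field k] {V : Type v} [Quiver.{w} V]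

/-- The compressed multiplicity `c^ξ_M(I)`: the multiplicity of the tour of `V_I` in the tour
of `M`, along the course `ξ(I)`. -/
noncomputable def compressedMultiplicity (ξ : EssentialAssignment.{v, w, c, d} V) (M : FCRep k V)
    (I : QuiverInterval V) : ℕ :=
  QuiverRep.multiplicity ((ξ.course I).tour M) ((ξ.course I).tour (intervalRep k I))

open Classical in
/-- `δ` is an interval approximation of `M`: `c^ξ_M(I)` is the sum of `δ(J)` over all intervals
`J ≥ I`, for every interval `I`. -/
def IsIntervalApproximation [Finite V] (ξ : EssentialAssignment.{v, w, c, d} V) (M : FCRep k V)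
    (δ : QuiverInterval V → ℤ) : Prop :=
  ∀ I, (compressedMultiplicity ξ M I : ℤ) = ∑ J with I ≤ J, δ J

open Classical in
theorem existsUnique_sum_above {P : Type*} [PartialOrder P] [Fintype P] (f : P → ℤ) :
    ∃! g : P → ℤ, ∀ x, f x = ∑ y with x ≤ y, g y := by
  have key : ∀ (g : P → ℤ) (x : P),
      ∑ y with x ≤ y, g y = g x + ∑ y : {y : P // x < y}, g y := by
    intro g x
    have h : (Finset.univ.filter fun y => x ≤ y) =
        insert x (Finset.univ.filter fun y => x < y) := by
      ext y
      simp [le_iff_eq_or_lt, eq_comm]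
    rw [h, Finset.sum_insert (by simp), Finset.sum_subtype (p := fun y => x < y)]
    simp
  have wf : WellFounded (fun a b : P => b < a) := wellFounded_gt
  refine ⟨wf.fix fun x ih => f x - ∑ y : {y : P // x < y}, ih y.1 y.2, ?_, ?_⟩
  · intro x
    rw [key, wf.fix_eq]
    ring
  · intro g hg
    funext x
    induction x using wf.induction with
    | _ x ih =>
      have h1 := hg x
      rw [key] at h1
      rw [wf.fix_eq, Finset.sum_congr rfl fun (y : {y : P // x < y}) _ => (ih y.1 y.2).symm]
      linarith

theorem existsUnique_isIntervalApproximation [Finite V] (ξ : EssentialAssignment.{v, w, c, d} V)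
    (M : FCRep k V) : ∃! δ : QuiverInterval V → ℤ, IsIntervalApproximation ξ M δ :=
  existsUnique_sum_above _

/-- The interval approximation `δ^ξ_M`: the unique integer-valued function on the intervals such
that `c^ξ_M(I)` is the sum of `δ^ξ_M(J)` over all intervals `J ≥ I`, for every interval `I`. -/
noncomputable def intervalApproximation [Finite V] (ξ : EssentialAssignment.{v, w, c, d} V)
    (M : FCRep k V) : QuiverInterval V → ℤ :=
  (existsUnique_isIntervalApproximation ξ M).choose

theorem intervalApproximation_spec [Finite V] (ξ : EssentialAssignment.{v, w, c, d} V)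
    (M : FCRep k V) : IsIntervalApproximation ξ M (intervalApproximation ξ M) :=
  (existsUnique_isIntervalApproximation ξ M).choose_spec.1

end approximation

/-! The formula is the defining equation of the interval approximation at one interval: the set S of
vertices between the ends a, b of p. By convexity S ≤ I holds exactly when a and b lie in I, which
is when V_I has rank 1 on p; otherwise that rank is 0 (`segment_le_iff`, `rank_intervalRep`). So the
right-hand side is the compressed multiplicity at S, and it remains to identify this with the rank
of M(p) (`multiplicity_tour_segment`).

Let N be the tour of M along the course of S. The tour of V_S is the constant representation K on
the ground field. Evaluation along paths from a and paths to b gives morphisms const M_a ⟶ N ⟶ const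
M_b with composite M(p). Acyclicity makes a and b essential in S, so both occur as labels; the first
morphism is bijective where the label is a, the second where it is b.

The multiplicity of K in N is then the rank of the composite. An indecomposable summand not
isomorphic to K contributes zero, since a nonzero contribution would make K a retract of it; a copy
of K contributes rank at most 1. Conversely, the copies of K lift to vectors of M_a whose images in
M_b are independent. Both bounds hold for every decomposition, so Krull-Schmidt is not needed, only
the existence of a decomposition. -/

/-! ### Connectedness and retracts of indecomposables -/

/-- A function on the vertices of a connected quiver that takes the same value at both ends of each
arrow is constant. -/
theorem apply_eq_of_connected {Q : Type c} [Quiver.{d} Q] (hQ : (underlyingGraph Q).Connected)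
    {T : Type*} (t : Q → T) (ht : ∀ {x y : Q}, (x ⟶ y) → t x = t y) (x y : Q) : t x = t y := by
  obtain ⟨p⟩ := hQ.preconnected x y
  induction p with
  | nil => rfl
  | cons h _ ih =>
    refine Eq.trans ?_ ih
    obtain ⟨-, ⟨⟨e⟩⟩ | ⟨⟨e⟩⟩⟩ := h
    · exact ht e
    · exact (ht e).symm

/-- An indecomposable object with a nonzero retract is isomorphic to it. -/
theorem CategoryTheory.Indecomposable.nonempty_iso_of_retract {C : Type*} [Category C] [Abelian C]
    {X L : C} (hX : Indecomposable X) (hL : ¬ IsZero L) (r : Retract L X) : Nonempty (X ≅ L) := by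
  have : IsSplitMono r.i := ⟨⟨r.splitMono⟩⟩
  -- The split mono exhibits X as L plus its cokernel; as L is nonzero, indecomposability kills the
  -- cokernel.
  have b := isBilimitBinaryBiconeOfIsSplitMonoOfCokernel (cokernelIsCokernel r.i)
  have h := hX.2 _ _ (biprod.uniqueUpToIso _ _ b)
  have hz := h.resolve_left hL
  have : Epi r.i := Preadditive.epi_of_isZero_cokernel _ hz
  have : IsIso r.i := isIso_of_epi_of_isSplitMono _
  exact ⟨(asIso r.i).symm⟩

/-! ### Morphisms from and to constant representations -/

section

variable {k : Type u} [Field k] {Q : Type c} [Quiver.{d} Q]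

namespace QuiverRep

/-- The linear map between the spaces at a vertex given by a morphism of representations. -/
def appLin {M N : QuiverRep k Q} (f : M ⟶ N) (x : Q) :
    M.obj ((Paths.of Q).obj x) →ₗ[k] N.obj ((Paths.of Q).obj x) :=
  (f.app ((Paths.of Q).obj x)).hom.hom

@[simp]
theorem appLin_id (M : QuiverRep k Q) (x : Q) : appLin (𝟙 M) x = LinearMap.id := rfl

@[simp]
theorem appLin_zero (M N : QuiverRep k Q) (x : Q) : appLin (0 : M ⟶ N) x = 0 := rfl

@[simp]
theorem appLin_comp {M N P : QuiverRep k Q} (f : M ⟶ N) (g : N ⟶ P) (x : Q) :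
    appLin (f ≫ g) x = appLin g x ∘ₗ appLin f x := rfl

@[simp]
theorem appLin_add {M N : QuiverRep k Q} (f g : M ⟶ N) (x : Q) :
    appLin (f + g) x = appLin f x + appLin g x := rfl

theorem appLin_sum {M N : QuiverRep k Q} {ι : Type*} (s : Finset ι) (f : ι → (M ⟶ N)) (x : Q) :
    appLin (∑ i ∈ s, f i) x = ∑ i ∈ s, appLin (f i) x :=
  map_sum (⟨⟨fun f => appLin f x, rfl⟩, fun _ _ => rfl⟩ : (M ⟶ N) →+ _) f s

theorem hom_ext {M N : QuiverRep k Q} {f g : M ⟶ N} (h : ∀ x, appLin f x = appLin g x) : f = g :=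
  NatTrans.ext (funext fun x => FGModuleCat.hom_ext (h x))

/-- The representation with the same space at all vertices, and identities as maps. -/
abbrev const (Q : Type c) [Quiver.{d} Q] (A : FGModuleCat.{u} k) : QuiverRep k Q :=
  (Functor.const (Paths Q)).obj A

/-- Naturality along an arrow acting by identities equates the components at its two ends;
connectedness does the rest. -/
theorem appLin_const_eq {A B : FGModuleCat.{u} k} (hQ : (underlyingGraph Q).Connected)
    (f : const Q A ⟶ const Q B) (x y : Q) :
    (appLin f x : A →ₗ[k] B) = appLin f y := by
  refine apply_eq_of_connected (T := A →ₗ[k] B) hQ (fun x => appLin f x) (fun {x y} e => ?_) x y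
  exact LinearMap.ext fun v => (congrArg (fun g => g.hom.hom v)
    (f.naturality ((Paths.of Q).map e))).symm

/-- A family of linear maps between the spaces of two representations that is natural with respect
to the arrows is a morphism. -/
def homMk {M N : QuiverRep k Q}
    (f : ∀ x : Q, M.obj ((Paths.of Q).obj x) →ₗ[k] N.obj ((Paths.of Q).obj x))
    (h : ∀ {x y : Q} (e : x ⟶ y) v, f y (M.eval e.toPath v) = N.eval e.toPath (f x v)) : M ⟶ N :=
  Paths.liftNatTrans (fun x => FGModuleCat.ofHom (f x))
    (fun e => FGModuleCat.hom_ext (LinearMap.ext fun v => h e v))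

/-- The morphism between constant representations given by a linear map. -/
def constMap {A B : FGModuleCat.{u} k} (g : A →ₗ[k] B) : const Q A ⟶ const Q B :=
  homMk (fun _ => g) (fun _ _ => rfl)

/-- The linear equivalence between the spaces at a vertex given by an isomorphism. -/
def appEquiv {M N : QuiverRep k Q} (e : M ≅ N) (x : Q) :
    M.obj ((Paths.of Q).obj x) ≃ₗ[k] N.obj ((Paths.of Q).obj x) :=
  LinearEquiv.ofLinearMap (appLin e.hom x) (appLin e.inv x)
    (by rw [← appLin_comp, e.inv_hom_id, appLin_id])
    (by rw [← appLin_comp, e.hom_inv_id, appLin_id])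

variable (Q k) in
/-- The constant representation on the ground field. -/
abbrev constUnit : QuiverRep k Q := const Q (FGModuleCat.of k k)

theorem not_isZero_of_ne {M : QuiverRep k Q} (x : Q) {v : M.obj ((Paths.of Q).obj x)}
    (hv : v ≠ 0) : ¬ IsZero M := fun h =>
  hv (congrArg (fun f : M ⟶ M => appLin f x v) (h.eq_of_src (𝟙 M) 0))

/-- If the composite `const A ⟶ X ⟶ const B` is nonzero and `X` is indecomposable, then `X` is the
constant representation on the ground field. -/
theorem nonempty_iso_constUnit {A B : FGModuleCat.{u} k} {X : QuiverRep k Q}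
    (hQ : (underlyingGraph Q).Connected) (hX : Indecomposable X) (f : const Q A ⟶ X)
    (g : X ⟶ const Q B) (x : Q) (v : A) (hv : appLin (f ≫ g) x v ≠ 0) :
    Nonempty (X ≅ constUnit k Q) := by
  -- With `v` as a map from `k` and `φ` as a map to `k`, the composite through X is the identity at
  -- `x`, hence at every vertex.
  obtain ⟨φ, hφ⟩ : ∃ φ : B →ₗ[k] k, φ (appLin (f ≫ g) x v) = 1 := by
    obtain ⟨φ, hφ⟩ := not_forall.1 (mt (Module.forall_dual_apply_eq_zero_iff k
      (appLin (f ≫ g) x v : B)).1 hv)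
    exact ⟨(φ (appLin (f ≫ g) x v))⁻¹ • φ, inv_mul_cancel₀ hφ⟩
  refine hX.nonempty_iso_of_retract (not_isZero_of_ne (M := constUnit k Q) x
    (one_ne_zero (α := k))) ⟨constMap (A := FGModuleCat.of k k) (LinearMap.toSpanSingleton k A v) ≫ f,
      g ≫ constMap (B := FGModuleCat.of k k) φ, hom_ext fun y => ?_⟩
  refine (appLin_const_eq hQ _ y x).trans (LinearMap.ext_ring ?_)
  refine Eq.trans ?_ hφ
  exact congrArg (fun w => φ (appLin (f ≫ g) x w)) (one_smul k v)

/-- The rank of a linear map `A → B` whose constant extension factors through a sum of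
indecomposables is at most the number of constant summands. -/
theorem finrank_range_le_of_hasMultiplicity {A B : FGModuleCat.{u} k} {N : QuiverRep k Q} {m : ℕ}
    (hQ : (underlyingGraph Q).Connected) (f : const Q A ⟶ N) (g : N ⟶ const Q B) (x : Q)
    (h : HasMultiplicity N (constUnit k Q) m) :
    Module.finrank k (LinearMap.range (appLin (f ≫ g) x)) ≤ m := by
  classical
  obtain ⟨n, X, hX, ⟨e⟩, rfl⟩ := h
  let i (j : Fin n) := f ≫ e.hom ≫ biproduct.π X j
  let r (j : Fin n) := biproduct.ι X j ≫ e.inv ≫ g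
  -- Split the composite over the summands by writing the identity of the biproduct as a sum of
  -- projections followed by inclusions.
  have hfg : appLin (f ≫ g) x = ∑ j, appLin (i j ≫ r j) x := by
    rw [← appLin_sum]
    congr 1
    have := biproduct.total (f := X)
    calc f ≫ g = f ≫ e.hom ≫ 𝟙 _ ≫ e.inv ≫ g := by simp
      _ = _ := by
        rw [← this, Preadditive.sum_comp, Preadditive.comp_sum, Preadditive.comp_sum]
        simp [i, r]
  have h1 (j : Fin n) : Module.finrank k (LinearMap.range (appLin (i j ≫ r j) x)) ≤
      if Nonempty (X j ≅ constUnit k Q) then 1 else 0 := by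
    split_ifs with hj
    · obtain ⟨e⟩ := hj
      rw [appLin_comp]
      refine (Submodule.finrank_mono (LinearMap.range_comp_le_range _ _)).trans ?_
      refine (LinearMap.finrank_range_le _).trans ?_
      exact ((appEquiv e x).finrank_eq.trans (Module.finrank_self k)).le
    · have : appLin (i j ≫ r j) x = 0 := by
        by_contra h0
        obtain ⟨v, hv⟩ := not_forall.1 (mt LinearMap.ext h0)
        exact hj (nonempty_iso_constUnit hQ (hX j) (i j) (r j) x v hv)
      rw [this, LinearMap.range_zero, finrank_bot]
  rw [hfg]
  have h2 := LinearMap.rank_finsetSum_le Finset.univ (fun j => appLin (i j ≫ r j) x)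
  simp only [LinearMap.rank, ← Module.finrank_eq_rank] at h2
  refine le_trans (by exact_mod_cast h2) ((Finset.sum_le_sum fun j _ => h1 j).trans ?_)
  rw [Finset.sum_boole, Nat.card_eq_fintype_card, Fintype.card_subtype]
  exact le_rfl

/-- The number of constant summands is at most the rank of the composite
`const A ⟶ N ⟶ const B`, if the first map is surjective at some vertex and the second is injective
at some vertex. -/
theorem le_finrank_range_of_hasMultiplicity {A B : FGModuleCat.{u} k} {N : QuiverRep k Q} {m : ℕ}
    (hQ : (underlyingGraph Q).Connected) (f : const Q A ⟶ N) (g : N ⟶ const Q B) (x y : Q)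
    (hf : Function.Surjective (appLin f x)) (hg : Function.Injective (appLin g y))
    (h : HasMultiplicity N (constUnit k Q) m) :
    m ≤ Module.finrank k (LinearMap.range (appLin (f ≫ g) y)) := by
  classical
  obtain ⟨n, X, hX, ⟨e⟩, rfl⟩ := h
  let S := {i // Nonempty (X i ≅ constUnit k Q)}
  let E (s : S) : X s.1 ≅ constUnit k Q := s.2.some
  let i (s : S) : constUnit k Q ⟶ N := (E s).inv ≫ biproduct.ι X s.1 ≫ e.inv
  let r (s : S) : N ⟶ constUnit k Q := e.hom ≫ biproduct.π X s.1 ≫ (E s).hom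
  have hir (s t : S) : i s ≫ r t = if s = t then 𝟙 _ else 0 := by
    split_ifs with hst
    · subst hst
      simp [i, r]
    · have : s.1 ≠ t.1 := fun h => hst (Subtype.ext h)
      simp [i, r, biproduct.ι_π_ne_assoc X this]
  -- Lift the generator of each constant summand through `f` at `x`, the vertex where `f` is
  -- surjective.
  choose v hv using fun s => hf (appLin (i s) x (1 : k))
  -- The lifts are controlled at `x`, but injectivity of `g` is known at `y`. The morphism `f ≫ r t`
  -- between constant representations has the same component at both, so the pairing moves from `x`
  -- to `y`.
  have hdual (s t : S) : appLin (r t) y (appLin f y (v s)) = if s = t then (1 : k) else 0 := by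
    have h1 := congrArg (fun φ : A →ₗ[k] k => φ (v s)) (appLin_const_eq hQ (f ≫ r t) y x)
    refine h1.trans ?_
    change appLin (r t) x (appLin f x (v s)) = _
    rw [hv]
    change appLin (i s ≫ r t) x (1 : k) = _
    rw [hir]
    split_ifs <;> rfl
  have hli : LinearIndependent k fun s => appLin f y (v s) := by
    rw [Fintype.linearIndependent_iff]
    intro c hc t
    have := congrArg (appLin (r t) y) hc
    rw [map_sum, map_zero] at this
    have h0 : ∑ s, (if s = t then c s else (0 : k)) = 0 := by simpa [hdual] using this
    rwa [Finset.sum_eq_single t (fun s _ h => if_neg h) (by simp), if_pos rfl] at h0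
  have hli' := (hli.map' (appLin g y) (LinearMap.ker_eq_bot.2 hg))
  have hmem (s : S) : appLin g y (appLin f y (v s)) ∈ LinearMap.range (appLin (f ≫ g) y) :=
    ⟨v s, rfl⟩
  have hli'' : LinearIndependent k fun s => (⟨_, hmem s⟩ : LinearMap.range (appLin (f ≫ g) y)) :=
    LinearIndependent.of_comp (Submodule.subtype _) hli'
  rw [Nat.card_eq_fintype_card]
  exact hli''.fintype_card_le_finrank

end QuiverRep
end

/-! ### Existence of decompositions into indecomposables -/

/-- The biproduct of two finite biproducts is the biproduct over the disjoint union. -/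
theorem nonempty_iso_biproduct_fin_add {C : Type*} [Category C] [Preadditive C]
    [HasFiniteBiproducts C] [HasBinaryBiproducts C] {m n : ℕ} {X Y Z : C} {f : Fin m → C}
    {g : Fin n → C} (e : X ≅ Y ⊞ Z) (eY : Y ≅ ⨁ f) (eZ : Z ≅ ⨁ g) :
    Nonempty (X ≅ ⨁ (Sum.elim f g ∘ finSumFinEquiv.symm : Fin (m + n) → C)) := by
  let ι (s : Fin m ⊕ Fin n) : Sum.elim f g s ⟶ X := match s with
    | .inl i => biproduct.ι f i ≫ eY.inv ≫ biprod.inl ≫ e.inv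
    | .inr i => biproduct.ι g i ≫ eZ.inv ≫ biprod.inr ≫ e.inv
  let π (s : Fin m ⊕ Fin n) : X ⟶ Sum.elim f g s := match s with
    | .inl i => e.hom ≫ biprod.fst ≫ eY.hom ≫ biproduct.π f i
    | .inr i => e.hom ≫ biprod.snd ≫ eZ.hom ≫ biproduct.π g i
  let b : Bicone (Sum.elim f g) :=
    { pt := X
      ι := ι
      π := π
      ι_π := by
        rintro (i | i) (j | j)
        · by_cases h : i = j
          · subst h; simp [ι, π]; rfl
          · simp [ι, π, biproduct.ι_π_ne f h, h]; rfl
        · simp [ι, π]; rfl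
        · simp [ι, π]; rfl
        · by_cases h : i = j
          · subst h; simp [ι, π]; rfl
          · simp [ι, π, biproduct.ι_π_ne g h, h]; rfl }
  have total : ∑ s, b.π s ≫ b.ι s = 𝟙 b.pt := by
    rw [Fintype.sum_sum_type]
    have h1 : ∑ i, b.π (.inl i) ≫ b.ι (.inl i) =
        (e.hom ≫ biprod.fst ≫ eY.hom) ≫ (∑ i, biproduct.π f i ≫ biproduct.ι f i) ≫
          eY.inv ≫ biprod.inl ≫ e.inv := by
      simp [b, ι, π, Preadditive.sum_comp, Preadditive.comp_sum, -biproduct.total]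
    have h2 : ∑ i, b.π (.inr i) ≫ b.ι (.inr i) =
        (e.hom ≫ biprod.snd ≫ eZ.hom) ≫ (∑ i, biproduct.π g i ≫ biproduct.ι g i) ≫
          eZ.inv ≫ biprod.inr ≫ e.inv := by
      simp [b, ι, π, Preadditive.sum_comp, Preadditive.comp_sum, -biproduct.total]
    rw [h1, h2, biproduct.total, biproduct.total]
    calc
      _ = e.hom ≫ (biprod.fst ≫ biprod.inl + biprod.snd ≫ biprod.inr) ≫ e.inv := by
        simp only [Category.id_comp, Category.assoc, Preadditive.add_comp, Preadditive.comp_add,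
          Iso.hom_inv_id_assoc]
      _ = _ := by rw [biprod.total]; simp [b]
  exact ⟨biproduct.uniqueUpToIso _ (isBilimitOfTotal b total) ≪≫
    (biproduct.reindex finSumFinEquiv.symm (Sum.elim f g)).symm⟩

namespace QuiverRep

variable {k : Type u} [Field k] {Q : Type c} [Quiver.{d} Q]

/-- The sum of the dimensions of the spaces of a representation. -/
noncomputable def totalDim (M : QuiverRep k Q) : ℕ :=
  ∑ᶠ x : Q, Module.finrank k (M.obj ((Paths.of Q).obj x))

theorem finrank_eq_add {X Y Z : QuiverRep k Q} (e : X ≅ Y ⊞ Z) (x : Q) :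
    Module.finrank k (X.obj ((Paths.of Q).obj x)) =
      Module.finrank k (Y.obj ((Paths.of Q).obj x)) +
        Module.finrank k (Z.obj ((Paths.of Q).obj x)) := by
  rw [(appEquiv e x).finrank_eq, ← Module.finrank_prod]
  have htotal := congrArg (fun f => appLin f x) (biprod.total (X := Y) (Y := Z))
  have h1 := congrArg (fun f => appLin f x) (biprod.inl_fst (X := Y) (Y := Z))
  have h2 := congrArg (fun f => appLin f x) (biprod.inl_snd (X := Y) (Y := Z))
  have h3 := congrArg (fun f => appLin f x) (biprod.inr_fst (X := Y) (Y := Z))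
  have h4 := congrArg (fun f => appLin f x) (biprod.inr_snd (X := Y) (Y := Z))
  simp only [appLin_comp, appLin_add, appLin_id, appLin_zero] at htotal h1 h2 h3 h4
  refine (LinearEquiv.ofLinearMap ((appLin biprod.fst x).prod (appLin biprod.snd x))
    ((appLin biprod.inl x).coprod (appLin biprod.inr x)) ?_ ?_).finrank_eq
  · rw [LinearMap.comp_coprod, LinearMap.prod_comp, LinearMap.prod_comp, h1, h2, h3, h4]
    exact LinearMap.coprod_inl_inr
  · rw [LinearMap.coprod_comp_prod]
    exact htotal

theorem totalDim_eq_add [Finite Q] {X Y Z : QuiverRep k Q} (e : X ≅ Y ⊞ Z) :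
    totalDim X = totalDim Y + totalDim Z := by
  unfold totalDim
  rw [← finsum_add_distrib (Set.toFinite _) (Set.toFinite _)]
  exact finsum_congr fun x => finrank_eq_add e x

theorem totalDim_pos [Finite Q] {X : QuiverRep k Q} (h : ¬ IsZero X) : 0 < totalDim X := by
  by_contra h0
  refine h ((IsZero.iff_id_eq_zero X).2 (hom_ext fun x => ?_))
  have : Fintype Q := Fintype.ofFinite Q
  have h1 : Module.finrank k (X.obj ((Paths.of Q).obj x)) = 0 := by
    rw [totalDim, finsum_eq_sum_of_fintype, not_lt, Nat.le_zero, Finset.sum_eq_zero_iff] at h0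
    exact h0 x (Finset.mem_univ x)
  have : Subsingleton (X.obj ((Paths.of Q).obj x)) := Module.finrank_zero_iff.1 h1
  exact LinearMap.ext fun v => Subsingleton.elim _ _

/-- Every representation of a quiver with finitely many vertices is a finite direct sum of
indecomposable representations. -/
theorem exists_iso_biproduct_indecomposable [Finite Q] (M : QuiverRep k Q) :
    ∃ (n : ℕ) (X : Fin n → QuiverRep k Q), (∀ i, Indecomposable (X i)) ∧ Nonempty (M ≅ ⨁ X) := by
  induction h : totalDim M using Nat.strong_induction_on generalizing M with
  | _ N ih =>
    by_cases hM : IsZero M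
    -- Indecomposables are nonzero by definition, so the zero representation is the empty sum.
    · refine ⟨0, Fin.elim0, fun i => i.elim0, ⟨hM.iso ((IsZero.iff_id_eq_zero _).2 ?_)⟩⟩
      exact biproduct.hom_ext _ _ fun i => i.elim0
    by_cases hM' : Indecomposable M
    · exact ⟨1, fun _ => M, fun _ => hM', ⟨(biproductUniqueIso fun _ : Fin 1 => M).symm⟩⟩
    simp only [Indecomposable, not_and, not_forall, not_or] at hM'
    obtain ⟨Y, Z, e, hY, hZ⟩ := hM' hM
    have hd := totalDim_eq_add e
    have hY' := totalDim_pos hY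
    have hZ' := totalDim_pos hZ
    obtain ⟨m, f, hf, ⟨eY⟩⟩ := ih _ (by omega) Y rfl
    obtain ⟨n, g, hg, ⟨eZ⟩⟩ := ih _ (by omega) Z rfl
    refine ⟨m + n, _, fun i => ?_, nonempty_iso_biproduct_fin_add e eY eZ⟩
    dsimp only [Function.comp]
    rcases finSumFinEquiv.symm i with j | j
    · exact hf j
    · exact hg j

/-! ### The multiplicity of the constant representation as a rank -/

theorem HasMultiplicity.congr_right {M L L' : QuiverRep k Q} (e : L ≅ L') {m : ℕ} :
    HasMultiplicity M L m ↔ HasMultiplicity M L' m := by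
  have (X : QuiverRep k Q) : Nonempty (X ≅ L) ↔ Nonempty (X ≅ L') :=
    ⟨fun ⟨f⟩ => ⟨f ≪≫ e⟩, fun ⟨f⟩ => ⟨f ≪≫ e.symm⟩⟩
  simp only [HasMultiplicity, this]

/-- The multiplicity of the constant representation in `N` is the rank of a composite
`const A ⟶ N ⟶ const B`, if the first map is surjective at some vertex and the second is injective
at some vertex. -/
theorem multiplicity_eq_finrank_range [Finite Q] {A B : FGModuleCat.{u} k} {N L : QuiverRep k Q}
    (hQ : (underlyingGraph Q).Connected) (e : L ≅ constUnit k Q) (f : const Q A ⟶ N)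
    (g : N ⟶ const Q B) (x y : Q)
    (hf : Function.Surjective (appLin f x)) (hg : Function.Injective (appLin g y)) :
    multiplicity N L = Module.finrank k (LinearMap.range (appLin (f ≫ g) y)) := by
  -- The two bounds pin down the count in any decomposition, so the supremum defining the
  -- multiplicity is over one value.
  have huniq (m : ℕ) (h : HasMultiplicity N L m) :
      m = Module.finrank k (LinearMap.range (appLin (f ≫ g) y)) := by
    rw [HasMultiplicity.congr_right e] at h
    exact le_antisymm (le_finrank_range_of_hasMultiplicity hQ f g x y hf hg h)
      (finrank_range_le_of_hasMultiplicity hQ f g y h)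
  obtain ⟨n, X, hX, hN⟩ := exists_iso_biproduct_indecomposable N
  have hset : {m | HasMultiplicity N L m} =
      {Module.finrank k (LinearMap.range (appLin (f ≫ g) y))} := by
    refine Set.eq_singleton_iff_unique_mem.2 ⟨?_, huniq⟩
    have h : HasMultiplicity N L _ := ⟨n, X, hX, hN, rfl⟩
    exact huniq _ h ▸ h
  rw [multiplicity, hset, csSup_singleton]

end QuiverRep

/-! ### Evaluation on paths, segments and ranks of interval representations -/

section

variable {k : Type u} [Field k] {V : Type v} [Quiver.{w} V]

theorem QuiverRep.eval_comp (M : QuiverRep k V) {a b c : V} (p : Quiver.Path a b)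
    (q : Quiver.Path b c) : M.eval (p.comp q) = M.eval q ∘ₗ M.eval p :=
  congrArg (fun f => f.hom.hom) (M.map_comp (X := (Paths.of V).obj a) (Y := (Paths.of V).obj b)
    (Z := (Paths.of V).obj c) p q)

theorem QuiverRep.eval_nil (M : QuiverRep k V) (a : V) :
    M.eval (Quiver.Path.nil : Quiver.Path a a) = LinearMap.id :=
  congrArg (fun f => f.hom.hom) (M.map_id ((Paths.of V).obj a))

theorem IsAcyclicQuiver.eq_nil (hV : IsAcyclicQuiver V) {a : V} (p : Quiver.Path a a) :
    p = Quiver.Path.nil :=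
  Quiver.Path.eq_nil_of_length_zero p (hV a p)

theorem IsAcyclicQuiver.eval_bijective (hV : IsAcyclicQuiver V) (M : QuiverRep k V) {a b : V}
    (h : a = b) (p : Quiver.Path a b) : Function.Bijective (M.eval p) := by
  subst h
  rw [hV.eq_nil p, QuiverRep.eval_nil]
  exact Function.bijective_id

/-- A representation of the fully commutative quiver on an acyclic quiver takes the same value on
any two parallel paths. -/
theorem FCRep.eval_eq (hV : IsAcyclicQuiver V) (M : FCRep k V) {a b : V} (p q : Quiver.Path a b) :
    M.obj.eval p = M.obj.eval q := by
  by_cases hab : a = b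
  · subst hab
    rw [hV.eq_nil p, hV.eq_nil q]
  · have pos (r : Quiver.Path a b) : 1 ≤ r.length :=
      Nat.one_le_iff_ne_zero.2 fun h => hab (Quiver.Path.eq_of_length_zero r h)
    exact M.property p q (pos p) (pos q)

namespace QuiverInterval

/-- The interval of all vertices that lie between the ends of a path. -/
def segment {a b : V} (p : Quiver.Path a b) : QuiverInterval V where
  carrier := {x | Nonempty (Quiver.Path a x) ∧ Nonempty (Quiver.Path x b)}
  connected := by
    set S : Set V := {x | Nonempty (Quiver.Path a x) ∧ Nonempty (Quiver.Path x b)}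
    have ha : a ∈ S := ⟨⟨.nil⟩, ⟨p⟩⟩
    have key {x : V} (q : Quiver.Path a x) (hx : x ∈ S) :
        ((underlyingGraph V).induce S).Reachable ⟨a, ha⟩ ⟨x, hx⟩ := by
      induction q with
      | nil => rfl
      | @cons y z q e ih =>
        have hy : y ∈ S := ⟨⟨q⟩, hx.2.map e.toPath.comp⟩
        refine (ih hy).trans ?_
        by_cases h : y = z
        · subst h; rfl
        · exact SimpleGraph.Adj.reachable ⟨h, Or.inl ⟨e⟩⟩
    exact (SimpleGraph.connected_iff_exists_forall_reachable _).2
      ⟨⟨a, ha⟩, fun x => x.2.1.elim fun q => key q x.2⟩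
  convex := fun ⟨⟨p₁⟩, _⟩ ⟨_, ⟨p₂⟩⟩ q₁ q₂ => ⟨⟨p₁.comp q₁⟩, ⟨q₂.comp p₂⟩⟩

theorem segment_le_iff {a b : V} (p : Quiver.Path a b) (I : QuiverInterval V) :
    segment p ≤ I ↔ a ∈ I.carrier ∧ b ∈ I.carrier :=
  ⟨fun h => ⟨h (show a ∈ (segment p).carrier from ⟨⟨.nil⟩, ⟨p⟩⟩),
    h (show b ∈ (segment p).carrier from ⟨⟨p⟩, ⟨.nil⟩⟩)⟩,
    fun h _ hx => hx.1.elim fun q₁ => hx.2.elim fun q₂ => I.convex h.1 h.2 q₁ q₂⟩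

/-- An arrow into `a` from a vertex reachable from `a` would close a nontrivial cycle. -/
theorem source_mem_essentialVertices_segment (hV : IsAcyclicQuiver V) {a b : V}
    (p : Quiver.Path a b) : a ∈ (segment p).essentialVertices :=
  ⟨⟨⟨.nil⟩, ⟨p⟩⟩, Or.inl fun _ ⟨⟨q⟩, _⟩ => ⟨fun e => Nat.succ_ne_zero _ (hV a (q.cons e))⟩⟩

theorem target_mem_essentialVertices_segment (hV : IsAcyclicQuiver V) {a b : V}
    (p : Quiver.Path a b) : b ∈ (segment p).essentialVertices :=
  ⟨⟨⟨p⟩, ⟨.nil⟩⟩, Or.inr fun y ⟨_, ⟨q⟩⟩ => ⟨fun e => Nat.succ_ne_zero _ (hV y (q.cons e))⟩⟩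

end QuiverInterval

variable (k) in
theorem coe_intervalMap (I : QuiverInterval V) {x y : V} (hx : x ∈ I.carrier) (hy : y ∈ I.carrier)
    (z : intervalSpace k I x) : (intervalMap k I x y z : k) = z := by
  rw [intervalMap, dif_pos ⟨hx, hy⟩]
  rfl

open Classical in
theorem rank_intervalRep (I : QuiverInterval V) {a b : V} (p : Quiver.Path a b) :
    QuiverRep.rank (intervalRep k I).obj p = if a ∈ I.carrier ∧ b ∈ I.carrier then 1 else 0 := by
  have h0 : QuiverRep.rank (intervalRep k I).obj p =
      Module.finrank k (LinearMap.range (intervalMap k I a b)) := by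
    rw [← intervalQuiverRep_eval k I p]
    rfl
  rw [h0]
  split_ifs with h
  · have hr : LinearMap.range (intervalMap k I a b) = ⊤ := by
      rw [LinearMap.range_eq_top]
      intro z
      refine ⟨⟨z, by simp [intervalSpace, h.1]⟩, Subtype.ext (coe_intervalMap k I h.1 h.2 _)⟩
    rw [hr, finrank_top, intervalSpace, if_pos h.2, finrank_top, Module.finrank_self]
  · rw [intervalMap, dif_neg h, LinearMap.range_zero, finrank_bot]

/-! ### Tours along an essential course of a segment -/

namespace Course

theorem tour_eval (C : Course.{v, w, c, d} V) (M : FCRep k V) {x y : C.vertex} (e : x ⟶ y) :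
    (C.tour M).eval e.toPath = M.obj.eval (Classical.choice (C.exists_path e)) := rfl

/-- The tour of an interval representation along a course in the interval is constant. -/
noncomputable def tourIntervalRepIso (C : Course.{v, w, c, d} V) (I : QuiverInterval V)
    (h : Set.range C.label ⊆ I.carrier) :
    C.tour (intervalRep k I) ≅ QuiverRep.constUnit k C.vertex :=
  have hmem (x : C.vertex) : C.label x ∈ I.carrier := h ⟨x, rfl⟩
  have hmap {x y : C.vertex} (e : x ⟶ y) (z : intervalSpace k I (C.label x)) :
      ((C.tour (intervalRep k I)).eval e.toPath z : intervalSpace k I (C.label y)).1 = z.1 := by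
    rw [tour_eval]
    refine Eq.trans ?_ (coe_intervalMap k I (hmem x) (hmem y) z)
    exact congrArg (fun f : intervalSpace k I (C.label x) →ₗ[k] intervalSpace k I (C.label y) =>
      (f z).1) (intervalQuiverRep_eval k I (Classical.choice (C.exists_path e)))
  have htop (x : C.vertex) (z : k) : z ∈ intervalSpace k I (C.label x) := by
    simp [intervalSpace, hmem x]
  { hom := QuiverRep.homMk (fun x => (intervalSpace k I (C.label x)).subtype) hmap
    inv := QuiverRep.homMk (fun x => LinearMap.codRestrict (intervalSpace k I (C.label x))
        LinearMap.id (htop x))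
      (fun {x _} e v => Subtype.ext (hmap e ⟨v, htop x v⟩).symm)
    hom_inv_id := QuiverRep.hom_ext fun x => rfl
    inv_hom_id := QuiverRep.hom_ext fun x => rfl }

/-- The multiplicity of the tour of the representation of a segment, along an essential course, is
the rank on a path between the ends of the segment. -/
theorem multiplicity_tour_segment (hV : IsAcyclicQuiver V) (C : Course.{v, w, c, d} V)
    (M : FCRep k V) {a b : V} (p : Quiver.Path a b)
    (hC : C.IsEssential (QuiverInterval.segment p)) :
    QuiverRep.multiplicity (C.tour M) (C.tour (intervalRep k (QuiverInterval.segment p))) =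
      QuiverRep.rank M.obj p := by
  have hmem (x : C.vertex) : C.label x ∈ (QuiverInterval.segment p).carrier := hC.2 ⟨x, rfl⟩
  let q (x : C.vertex) : Quiver.Path a (C.label x) := (hmem x).1.some
  let r (x : C.vertex) : Quiver.Path (C.label x) b := (hmem x).2.some
  obtain ⟨x, hx⟩ := hC.1 (QuiverInterval.source_mem_essentialVertices_segment hV p)
  obtain ⟨y, hy⟩ := hC.1 (QuiverInterval.target_mem_essentialVertices_segment hV p)
  -- Naturality of `f` and `g` is path independence: extending the chosen path by the path under an
  -- arrow gives a path parallel to the one chosen at the other end.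
  let f : QuiverRep.const C.vertex (M.obj.obj ((Paths.of V).obj a)) ⟶ C.tour M :=
    QuiverRep.homMk (fun x => M.obj.eval (q x)) fun {x y} e z =>
      LinearMap.congr_fun ((FCRep.eval_eq hV M (q y)
        ((q x).comp (Classical.choice (C.exists_path e)))).trans (QuiverRep.eval_comp _ _ _)) z
  let g : C.tour M ⟶ QuiverRep.const C.vertex (M.obj.obj ((Paths.of V).obj b)) :=
    QuiverRep.homMk (fun x => M.obj.eval (r x)) fun {x y} e z =>
      LinearMap.congr_fun ((QuiverRep.eval_comp _ _ _).symm.trans (FCRep.eval_eq hV M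
        ((Classical.choice (C.exists_path e)).comp (r y)) (r x))) z
  -- The composite at `y` is evaluation along a path from `a` to `b` through the label of `y`, which
  -- is parallel to `p`.
  rw [QuiverRep.multiplicity_eq_finrank_range C.connected (C.tourIntervalRepIso _ hC.2) f g x y
    (hV.eval_bijective M.obj hx.symm _).2 (hV.eval_bijective M.obj hy _).1, QuiverRep.rank,
    FCRep.eval_eq hV M p ((q y).comp (r y)), QuiverRep.eval_comp]
  rfl

end Course

end

theorem mainTheorem1 {k : Type u} [Field k] {V : Type v} [Quiver.{w} V] [Finite V]
    [∀ a b : V, Finite (a ⟶ b)] (hV : IsAcyclicQuiver V)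
    (ξ : EssentialAssignment.{v, w, c, d} V) (M : FCRep k V) {a b : V} (p : Quiver.Path a b) :
    (QuiverRep.rank M.obj p : ℤ) =
      ∑ I : QuiverInterval V,
        intervalApproximation ξ M I * (QuiverRep.rank (intervalRep k I).obj p : ℤ) := by
  classical
  rw [← Course.multiplicity_tour_segment hV (ξ.course (QuiverInterval.segment p)) M p
    (ξ.isEssential _)]
  -- The sum over intervals above the segment becomes a sum over all intervals, with the rank of the
  -- interval representation on `p` as indicator.
  refine (intervalApproximation_spec ξ M (QuiverInterval.segment p)).trans ?_
  rw [Finset.sum_filter]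
  refine Finset.sum_congr rfl fun I _ => ?_
  rw [rank_intervalRep]
  simp only [QuiverInterval.segment_le_iff]
  split_ifs <;> simp
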